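/- Let $G=(V,E)$ be a unit disk graph, that is, a finite simple graph whose vertices can be mapped to points of the Euclidean plane in such a way that two distinct vertices are adjacent if and only if their points are at Euclidean distance at most $1$. Let $r \ge 1$ be an integer and let $v \in V$. The closed $r$-neighborhood of $v$ is the set of all vertices $w$ whose graph distance from $v$ in $G$ is at most $r$. Then every independent set of $G$ (a set of pairwise non-adjacent vertices) contained in the closed $r$-neighborhood of $v$ has at most $$\left\lfloor \frac{\pi (2r+1)^2}{\sqrt{12}} \right\rfloor$$ vertices. -/

import Mathlib

/-- `G` is a unit disk graph: its vertices can be mapped to points of the Euclidean plane so that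
two distinct vertices are adjacent exactly when their points are at distance at most `1`.
Equivalently, closed disks of diameter `1` centred at the points intersect. -/
def SimpleGraph.IsUnitDiskGraph {V : Type*} (G : SimpleGraph V) : Prop :=
  ∃ p : V → EuclideanSpace ℝ (Fin 2), ∀ u v : V, G.Adj u v ↔ u ≠ v ∧ Dist.dist (p u) (p v) ≤ 1

/-- The closed `r`-neighborhood of `v`: the vertices whose distance to `v` in `G` is at most `r`.
The extended distance is used, so that it is infinite between different components. -/
def SimpleGraph.closedNeighborhood {V : Type*} (G : SimpleGraph V) (r : ℕ) (v : V) : Set V :=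
  {w | G.edist v w ≤ r}

open MeasureTheory Set
open scoped ComplexConjugate ENNReal

/-! Paths in `G` map to chains of steps of length at most 1, so an independent set becomes a set of
points in a disk of radius `r` with mutual distances greater than 1. The bound is then hexagonal
packing density in the disk of radius `r + 1/2`: each point owns a Voronoi cell, truncated to that
disk and to the disk of radius `R = 1/√3` about the point, of area at least `√3/2`, the area of the
regular hexagon of inradius `1/2` (`le_volume_real_truncatedCell`).

For this local bound, the small disk has area `π/3`, and each neighbour cuts off at most a circular
cap. A cap has at most `κ = 1 - 3√3/(2π)` times the area of the sector it subtends
(`volume_real_cap_le_sector`), and sectors of different neighbours are disjoint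
(`not_mem_two_sectors`). What sticks out of the large disk is charged in the same ratio to one more
disjoint sector (`exists_boundary_sector`). The total loss is at most `κ · π/3 = π/3 - √3/2`. -/

/-! ### Areas of sectors, triangles and caps. -/

theorem Complex.volume_real_sector {R c : ℝ} (hR : 0 ≤ R) (hc : -1 < c) (hc1 : c ≤ 1) :
    volume.real {z : ℂ | 0 < ‖z‖ ∧ ‖z‖ < R ∧ c * ‖z‖ ≤ z.re} = R ^ 2 * Real.arccos c := by
  have hmeas : MeasurableSet {z : ℂ | 0 < ‖z‖ ∧ ‖z‖ < R ∧ c * ‖z‖ ≤ z.re} := by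
    exact (measurableSet_lt measurable_const measurable_norm).inter
      ((measurableSet_lt measurable_norm measurable_const).inter
        (measurableSet_le (measurable_norm.const_mul c) Complex.measurable_re))
  have hpi : Real.arccos c < Real.pi := by
    refine lt_of_le_of_ne (Real.arccos_le_pi c) fun h => ?_
    rw [Real.arccos_eq_pi] at h
    linarith
  have h0 := Real.arccos_nonneg c
  have key : volume {z : ℂ | 0 < ‖z‖ ∧ ‖z‖ < R ∧ c * ‖z‖ ≤ z.re}
      = ENNReal.ofReal (R ^ 2 * Real.arccos c) := by
    rw [← lintegral_indicator_one hmeas, ← Complex.lintegral_comp_polarCoord_symm]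
    have hset : MeasurableSet (Ioo 0 R ×ˢ Icc (-Real.arccos c) (Real.arccos c)) :=
      measurableSet_Ioo.prod measurableSet_Icc
    have hsub : Ioo 0 R ×ˢ Icc (-Real.arccos c) (Real.arccos c) ⊆ polarCoord.target := by
      rintro ⟨ρ, θ⟩ ⟨⟨h1, h2⟩, h3, h4⟩
      simp only at h1 h2 h3 h4
      refine ⟨h1, ?_, ?_⟩ <;> simp only <;> linarith
    have e1 : ∫⁻ p in polarCoord.target, ENNReal.ofReal p.1 •
          ({z : ℂ | 0 < ‖z‖ ∧ ‖z‖ < R ∧ c * ‖z‖ ≤ z.re}.indicator 1 (Complex.polarCoord.symm p))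
        = ∫⁻ p in polarCoord.target,
          (Ioo 0 R ×ˢ Icc (-Real.arccos c) (Real.arccos c)).indicator
            (fun p : ℝ × ℝ => ENNReal.ofReal p.1) p := by
      refine setLIntegral_congr_fun polarCoord.open_target.measurableSet ?_
      rintro ⟨ρ, θ⟩ ⟨h1, h2, h3⟩
      simp only [mem_Ioi] at h1 h2 h3
      have hiff : Complex.polarCoord.symm (ρ, θ) ∈
          {z : ℂ | 0 < ‖z‖ ∧ ‖z‖ < R ∧ c * ‖z‖ ≤ z.re} ↔
          (ρ, θ) ∈ Ioo 0 R ×ˢ Icc (-Real.arccos c) (Real.arccos c) := by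
        have hn : ‖Complex.polarCoord.symm (ρ, θ)‖ = ρ := by
          rw [Complex.norm_polarCoord_symm, abs_of_pos h1]
        have hre : (Complex.polarCoord.symm (ρ, θ)).re = ρ * Real.cos θ := by
          simp [Complex.polarCoord_symm_apply, -Complex.ofReal_cos]
        have hcos : c ≤ Real.cos θ ↔ |θ| ≤ Real.arccos c := by
          have ht : |θ| ≤ Real.pi := abs_le.2 ⟨h2.le, h3.le⟩
          constructor
          · intro h
            rw [← Real.cos_abs] at h
            have := Real.arccos_le_arccos h
            rwa [Real.arccos_cos (abs_nonneg _) ht] at this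
          · intro h
            have := Real.cos_le_cos_of_nonneg_of_le_pi (abs_nonneg θ) hpi.le h
            rwa [Real.cos_abs, Real.cos_arccos hc.le hc1] at this
        simp only [mem_ofPred_eq, hn, hre, mem_prod, mem_Ioo, mem_Icc, ← abs_le, ← hcos]
        rw [mul_comm c, mul_le_mul_iff_right₀ h1]
        tauto
      by_cases h : (ρ, θ) ∈ Ioo 0 R ×ˢ Icc (-Real.arccos c) (Real.arccos c)
      · simp only [indicator_of_mem h, indicator_of_mem (hiff.2 h)]
        simp
      · simp only [indicator_of_notMem h, indicator_of_notMem (mt hiff.1 h)]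
        simp
    rw [e1, setLIntegral_indicator hset, inter_eq_left.2 hsub, Measure.volume_eq_prod,
      setLIntegral_prod _ (by fun_prop)]
    simp only [lintegral_const, MeasurableSet.univ, Measure.restrict_apply, univ_inter,
      Real.volume_Icc]
    rw [lintegral_mul_const _ (by fun_prop), ← ofReal_integral_eq_lintegral_ofReal,
      ← ENNReal.ofReal_mul, ← integral_Ioc_eq_integral_Ioo, ← intervalIntegral.integral_of_le hR,
      integral_id]
    · congr 1
      ring
    · exact setIntegral_nonneg measurableSet_Ioo fun x hx => hx.1.le
    · exact (continuous_id.integrableOn_Icc (a := 0) (b := R)).mono_set Ioo_subset_Icc_self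
    · exact (ae_restrict_mem measurableSet_Ioo).mono fun x hx => hx.1.le
  rw [measureReal_def, key, ENNReal.toReal_ofReal (by positivity)]

theorem Complex.volume_real_triangle {t m : ℝ} (ht : 0 ≤ t) (hm : 0 ≤ m) :
    volume.real {z : ℂ | z.re ∈ Ioo 0 t ∧ z.im ∈ Ioo (-(m * z.re)) (m * z.re)} = m * t ^ 2 := by
  have h : {z : ℂ | z.re ∈ Ioo 0 t ∧ z.im ∈ Ioo (-(m * z.re)) (m * z.re)} =
      Complex.measurableEquivRealProd ⁻¹'
        regionBetween (fun x => -(m * x)) (fun x => m * x) (Ioo 0 t) := by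
    ext z
    simp [regionBetween, Complex.measurableEquivRealProd_apply]
  rw [measureReal_def, h, Complex.volume_preserving_equiv_real_prod.measure_preimage_equiv,
    Measure.volume_eq_prod, volume_regionBetween_eq_integral]
  · rw [← integral_Ioc_eq_integral_Ioo, ← intervalIntegral.integral_of_le ht]
    have : ∀ x : ℝ, ((fun x => m * x) - (fun x => -(m * x))) x = (2 * m) * x := fun x => by
      simp only [Pi.sub_apply]; ring
    simp only [this]
    rw [intervalIntegral.integral_const_mul, integral_id, ENNReal.toReal_ofReal]
    · ring
    · rw [zero_pow two_ne_zero, sub_zero]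
      positivity
  · exact ((by fun_prop : Continuous fun x : ℝ => -(m * x)).integrableOn_Icc
      (a := 0) (b := t)).mono_set Ioo_subset_Icc_self
  · exact ((by fun_prop : Continuous fun x : ℝ => m * x).integrableOn_Icc
      (a := 0) (b := t)).mono_set Ioo_subset_Icc_self
  · exact measurableSet_Ioo
  · intro x hx
    have := mul_nonneg hm hx.1.le
    linarith

/-- The cap and the isosceles triangle from the centre to its chord are disjoint inside the sector;
`m` is the slope of the bounding radii. -/
theorem Complex.volume_real_cap_le {R t : ℝ} (ht : 0 < t) (htR : t < R) :
    volume.real {z : ℂ | ‖z‖ < R ∧ t ≤ z.re} ≤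
      R ^ 2 * Real.arccos (t / R) - t * √(R ^ 2 - t ^ 2) := by
  have hR : 0 < R := ht.trans htR
  have hc0 : 0 < t / R := by positivity
  have hsq : √(R ^ 2 - t ^ 2) ^ 2 = R ^ 2 - t ^ 2 := Real.sq_sqrt (by nlinarith)
  set m := √(R ^ 2 - t ^ 2) / t with hm
  have hm0 : 0 ≤ m := by positivity
  have hm2 : t ^ 2 * (1 + m ^ 2) = R ^ 2 := by
    rw [hm, div_pow, hsq]; field_simp
    try ring
  have hT := Complex.volume_real_triangle ht.le hm0
  have hS := Complex.volume_real_sector hR.le (by linarith : -1 < t / R)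
    ((div_le_one hR).2 htR.le)
  have hmT : MeasurableSet {z : ℂ | z.re ∈ Ioo 0 t ∧ z.im ∈ Ioo (-(m * z.re)) (m * z.re)} := by
    exact ((measurableSet_lt measurable_const Complex.measurable_re).inter
      (measurableSet_lt Complex.measurable_re measurable_const)).inter
      ((measurableSet_lt (Complex.measurable_re.const_mul m).neg Complex.measurable_im).inter
      (measurableSet_lt Complex.measurable_im (Complex.measurable_re.const_mul m)))
  have hdisj : Disjoint {z : ℂ | ‖z‖ < R ∧ t ≤ z.re}
      {z : ℂ | z.re ∈ Ioo 0 t ∧ z.im ∈ Ioo (-(m * z.re)) (m * z.re)} := by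
    rw [Set.disjoint_left]
    rintro z ⟨-, h1⟩ ⟨⟨-, h2⟩, -⟩
    linarith
  have hsub : {z : ℂ | ‖z‖ < R ∧ t ≤ z.re} ∪
      {z : ℂ | z.re ∈ Ioo 0 t ∧ z.im ∈ Ioo (-(m * z.re)) (m * z.re)} ⊆
      {z : ℂ | 0 < ‖z‖ ∧ ‖z‖ < R ∧ t / R * ‖z‖ ≤ z.re} := by
    rintro z (⟨h1, h2⟩ | ⟨⟨h1, h2⟩, h3, h4⟩)
    · refine ⟨lt_of_lt_of_le ht (h2.trans (Complex.re_le_norm z)), h1, ?_⟩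
      refine le_trans ?_ h2
      calc t / R * ‖z‖ ≤ t / R * R := by gcongr
        _ = t := by field_simp
    · have hz : ‖z‖ ^ 2 = z.re ^ 2 + z.im ^ 2 := by
        rw [Complex.sq_norm, Complex.normSq_apply]; ring
      have h5 : z.im ^ 2 ≤ (m * z.re) ^ 2 := sq_le_sq' h3.le h4.le
      have h6 : t * ‖z‖ ≤ R * z.re := by
        refine (pow_le_pow_iff_left₀ (by positivity) (by positivity) two_ne_zero).1 ?_
        rw [mul_pow, mul_pow, ← hm2, hz]
        nlinarith [mul_le_mul_of_nonneg_left h5 (sq_nonneg t)]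
      refine ⟨lt_of_lt_of_le h1 (Complex.re_le_norm z), ?_, ?_⟩
      · have : R * z.re < R * t := by gcongr
        nlinarith
      · rw [div_mul_eq_mul_div, div_le_iff₀ hR]; linarith
  have hfin : volume {z : ℂ | 0 < ‖z‖ ∧ ‖z‖ < R ∧ t / R * ‖z‖ ≤ z.re} ≠ ∞ := by
    refine ne_top_of_le_ne_top (b := volume (Metric.ball (0:ℂ) R)) measure_ball_lt_top.ne
      (measure_mono fun z hz => ?_)
    simpa using hz.2.1
  have h1 := measureReal_mono hsub hfin
  have hfin2 := ne_top_of_le_ne_top hfin (measure_mono hsub)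
  rw [measureReal_union hdisj hmT (ne_top_of_le_ne_top hfin2 (measure_mono subset_union_left))
    (ne_top_of_le_ne_top hfin2 (measure_mono subset_union_right)), hT, hS] at h1
  have : m * t ^ 2 = t * √(R ^ 2 - t ^ 2) := by rw [hm]; field_simp
  linarith

theorem Complex.volume_real_preimage_mul {u : ℂ} (hu : ‖u‖ = 1) (s : Set ℂ) :
    volume.real ((fun z => u * z) ⁻¹' s) = volume.real s := by
  let w : Circle := ⟨u, by simpa [Submonoid.unitSphere] using hu⟩
  have := (rotation w).measurePreserving.measure_preimage_emb
    (rotation w).toHomeomorph.measurableEmbedding s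
  rw [measureReal_def, measureReal_def, ← this]
  rfl

theorem Complex.inner_mul_self_left {u : ℂ} (hu : ‖u‖ = 1) (z : ℂ) :
    inner ℝ u (u * z) = z.re := by
  have h : u.re * u.re + u.im * u.im = 1 := by
    rw [← Complex.normSq_apply, ← Complex.sq_norm, hu, one_pow]
  rw [Complex.inner]
  simp only [Complex.mul_re, Complex.mul_im, Complex.conj_re, Complex.conj_im]
  linear_combination z.re * h

theorem Complex.volume_real_sector_inner {u : ℂ} (hu : ‖u‖ = 1) {R c : ℝ} (hR : 0 ≤ R)
    (hc : -1 < c) (hc1 : c ≤ 1) :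
    volume.real {z : ℂ | 0 < ‖z‖ ∧ ‖z‖ < R ∧ c * ‖z‖ ≤ inner ℝ u z} = R ^ 2 * Real.arccos c := by
  rw [← Complex.volume_real_sector hR hc hc1,
    ← Complex.volume_real_preimage_mul hu]
  congr 1
  ext z
  simp only [mem_preimage, mem_ofPred_eq, Complex.inner_mul_self_left hu, norm_mul, hu, one_mul]

theorem Complex.volume_real_cap_inner_le {u : ℂ} (hu : ‖u‖ = 1) {R t : ℝ} (ht : 0 < t)
    (htR : t < R) :
    volume.real {z : ℂ | ‖z‖ < R ∧ t ≤ inner ℝ u z} ≤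
      R ^ 2 * Real.arccos (t / R) - t * √(R ^ 2 - t ^ 2) := by
  refine le_trans (le_of_eq ?_) (Complex.volume_real_cap_le ht htR)
  rw [← Complex.volume_real_preimage_mul hu]
  congr 1
  ext z
  simp only [mem_preimage, mem_ofPred_eq, Complex.inner_mul_self_left hu, norm_mul, hu, one_mul]

/-! ### Comparison of a cap with a sector. -/

/-- By concavity, `sin (2φ)` lies above its chord over `[0, π/3]`. Equality at `φ = π/6` is the
hexagonal case. -/
theorem Real.mul_le_sin_mul_cos {φ : ℝ} (h0 : 0 ≤ φ) (h : φ ≤ Real.pi / 6) :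
    3 * √3 / (2 * Real.pi) * φ ≤ Real.sin φ * Real.cos φ := by
  have hpi := Real.pi_pos
  have hm0 : (0 : ℝ) ∈ Icc 0 Real.pi := ⟨le_rfl, hpi.le⟩
  have hm1 : Real.pi / 3 ∈ Icc 0 Real.pi := ⟨by positivity, by linarith⟩
  have hab : 0 ≤ 1 - 6 * φ / Real.pi := by rw [sub_nonneg, div_le_one hpi]; linarith
  have hb : 0 ≤ 6 * φ / Real.pi := by positivity
  have hc := strictConcaveOn_sin_Icc.concaveOn.2 hm0 hm1 hab hb (by ring)
  have e : (1 - 6 * φ / Real.pi) • (0 : ℝ) + (6 * φ / Real.pi) • (Real.pi / 3) = 2 * φ := by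
    simp only [smul_eq_mul]; field_simp; ring
  rw [e, Real.sin_two_mul, Real.sin_zero, Real.sin_pi_div_three] at hc
  simp only [smul_eq_mul, mul_zero, zero_add] at hc
  have e2 : 6 * φ / Real.pi * (√3 / 2) = 2 * (3 * √3 / (2 * Real.pi) * φ) := by
    field_simp; ring
  linarith

theorem cap_area_le_mul_arccos {R t : ℝ} (hR : 0 < R) (hR2 : R ^ 2 = 1 / 3) (ht : 1 / 2 ≤ t)
    (htR : t ≤ R) :
    R ^ 2 * Real.arccos (t / R) - t * √(R ^ 2 - t ^ 2) ≤
      (1 - 3 * √3 / (2 * Real.pi)) * (R ^ 2 * Real.arccos (t / R)) := by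
  set φ := Real.arccos (t / R) with hφ
  have hc1 : t / R ≤ 1 := (div_le_one hR).2 htR
  have h3 : √3 ^ 2 = 3 := Real.sq_sqrt (by norm_num)
  have hR3 : √3 * R = 1 := by
    have : (√3 * R) ^ 2 = 1 ^ 2 := by rw [mul_pow, h3, hR2]; norm_num
    exact (pow_left_inj₀ (by positivity) zero_le_one two_ne_zero).1 this
  have h6 : φ ≤ Real.pi / 6 := by
    rw [hφ, ← Real.arccos_cos (x := Real.pi / 6) (by positivity) (by linarith [Real.pi_pos]),
      Real.cos_pi_div_six]
    refine Real.arccos_le_arccos ?_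
    rw [le_div_iff₀ hR]
    linarith
  have hcos : t = R * Real.cos φ := by
    rw [hφ, Real.cos_arccos (by have : 0 ≤ t / R := by positivity
                                linarith) hc1]
    field_simp
  have hsin : √(R ^ 2 - t ^ 2) = R * Real.sin φ := by
    have hs : 0 ≤ Real.sin φ := Real.sin_nonneg_of_nonneg_of_le_pi (Real.arccos_nonneg _)
      (Real.arccos_le_pi _)
    rw [← Real.sqrt_sq (by positivity : 0 ≤ R * Real.sin φ)]
    congr 1
    rw [hcos, mul_pow, mul_pow, Real.sin_sq]; ring
  rw [hsin]
  have := mul_le_mul_of_nonneg_left (Real.mul_le_sin_mul_cos (Real.arccos_nonneg _) h6)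
    (sq_nonneg R)
  have e : t * (R * Real.sin φ) = R ^ 2 * (Real.sin φ * Real.cos φ) := by
    rw [hcos]; ring
  rw [e]
  linarith

/-- This cap has half-angle above `π/6`, so its own sector is too small for the ratio `κ`; a sector
of half-angle slightly below `π/3` suffices. -/
theorem cap_area_le_mul_arccos_of_wide {R : ℝ} (hR : 0 < R) (hR2 : R ^ 2 = 1 / 3) :
    R ^ 2 * Real.arccos (11 / 24 / R) - 11 / 24 * √(R ^ 2 - (11 / 24) ^ 2) ≤
      (1 - 3 * √3 / (2 * Real.pi)) * (R ^ 2 * Real.arccos (53 / 100)) := by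
  have hpi1 := Real.pi_gt_d4
  have hpi2 := Real.pi_lt_d4
  have h3 : √3 ^ 2 = 3 := Real.sq_sqrt (by norm_num)
  have h31 : 1.732 < √3 := Real.lt_sqrt_of_sq_lt (by norm_num)
  have h32 : √3 < 1.7321 := (Real.sqrt_lt' (by norm_num)).2 (by norm_num)
  have hR3 : √3 * R = 1 := by
    have : (√3 * R) ^ 2 = 1 ^ 2 := by rw [mul_pow, h3, hR2]; norm_num
    exact (pow_left_inj₀ (by positivity) zero_le_one two_ne_zero).1 this
  -- Numerically the excess over `π/6` is about 0.130, and `arccos 0.53` falls short of `π/3` by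
  -- about 0.035.
  have hφ : Real.arccos (11 / 24 / R) ≤ Real.pi / 6 + 0.132 := by
    rw [← Real.arccos_cos (x := Real.pi / 6 + 0.132) (by positivity) (by linarith),
      Real.cos_add, Real.cos_pi_div_six, Real.sin_pi_div_six]
    refine Real.arccos_le_arccos ?_
    rw [le_div_iff₀ hR]
    have hc := (abs_le.1 (Real.cos_bound (x := 0.132) (by norm_num [abs_of_pos]))).2
    have hs := Real.sin_gt_sub_cube (x := 0.132) (by norm_num)
    rw [abs_of_pos (by norm_num)] at hc
    norm_num at hc hs ⊢
    have hR' : R = √3 / 3 := by nlinarith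
    rw [hR']
    nlinarith
  have hα : Real.pi / 3 - 0.036 ≤ Real.arccos (53 / 100) := by
    rw [← Real.arccos_cos (x := Real.pi / 3 - 0.036) (by linarith) (by linarith),
      Real.cos_sub, Real.cos_pi_div_three, Real.sin_pi_div_three]
    refine Real.arccos_le_arccos ?_
    have hc := Real.one_sub_sq_div_two_le_cos (x := 0.036)
    have hs := Real.sin_gt_sub_cube (x := 0.036) (by norm_num)
    norm_num at hc hs ⊢
    nlinarith
  have hsq : 8.426 / 24 ≤ √(R ^ 2 - (11 / 24) ^ 2) := by
    apply Real.le_sqrt_of_sq_le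
    rw [hR2]; norm_num
  have hk0 : 3 * √3 / (2 * Real.pi) ≤ 0.8271 := by
    rw [div_le_iff₀ (by positivity)]; linarith
  have hmul := mul_le_mul_of_nonneg_left hα (by linarith : 0 ≤ 1 - 3 * √3 / (2 * Real.pi))
  have hk : 3 * √3 / (2 * Real.pi) * (Real.pi / 3 - 0.036) ≤ √3 / 2 - 0.036 * 0.8269 := by
    have e : 3 * √3 / (2 * Real.pi) * (Real.pi / 3) = √3 / 2 := by field_simp
    have : 0.8269 ≤ 3 * √3 / (2 * Real.pi) := by
      rw [le_div_iff₀ (by positivity)]; linarith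
    rw [mul_sub, e]; linarith
  rw [hR2] at hsq ⊢
  linarith

/-- The cap lies beyond the bisector of `0` and `v`; the sector consists of the `z` whose radial
projection to the circle of radius `R` lies in that half-plane. For `‖v‖ ≥ 2R` the cap is empty. -/
theorem volume_real_cap_le_sector {R : ℝ} (hR : 0 < R) (hR2 : R ^ 2 = 1 / 3) {v : ℂ}
    (hv : 1 ≤ ‖v‖) :
    volume.real {z : ℂ | ‖z‖ < R ∧ ‖v‖ ^ 2 ≤ 2 * inner ℝ v z} ≤
      (1 - 3 * √3 / (2 * Real.pi)) *
        volume.real {z : ℂ | 0 < ‖z‖ ∧ ‖z‖ < R ∧ ‖z‖ * ‖v‖ ^ 2 ≤ 2 * R * inner ℝ v z} := by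
  have hv0 : 0 < ‖v‖ := by linarith
  rcases lt_or_ge ‖v‖ (2 * R) with h | h
  · have hu : ‖((‖v‖⁻¹ : ℝ) : ℂ) * v‖ = 1 := by
      rw [norm_mul, Complex.norm_real, norm_inv, norm_norm, inv_mul_cancel₀ hv0.ne']
    have hin : ∀ z : ℂ, inner ℝ v z = ‖v‖ * inner ℝ (((‖v‖⁻¹ : ℝ) : ℂ) * v) z := fun z => by
      rw [← Complex.real_smul, real_inner_smul_left, ← mul_assoc, mul_inv_cancel₀ hv0.ne', one_mul]
    have e1 : {z : ℂ | ‖z‖ < R ∧ ‖v‖ ^ 2 ≤ 2 * inner ℝ v z} =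
        {z : ℂ | ‖z‖ < R ∧ ‖v‖ / 2 ≤ inner ℝ (((‖v‖⁻¹ : ℝ) : ℂ) * v) z} := by
      ext z
      rw [mem_ofPred_eq, mem_ofPred_eq, hin z, and_congr_right_iff]
      intro _
      constructor <;> intro h1 <;> nlinarith
    have e2 : {z : ℂ | 0 < ‖z‖ ∧ ‖z‖ < R ∧ ‖z‖ * ‖v‖ ^ 2 ≤ 2 * R * inner ℝ v z} =
        {z : ℂ | 0 < ‖z‖ ∧ ‖z‖ < R ∧
          ‖v‖ / 2 / R * ‖z‖ ≤ inner ℝ (((‖v‖⁻¹ : ℝ) : ℂ) * v) z} := by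
      ext z
      rw [mem_ofPred_eq, mem_ofPred_eq, hin z, and_congr_right_iff]
      refine fun _ => and_congr_right_iff.2 fun _ => ?_
      rw [div_mul_eq_mul_div, div_le_iff₀ hR]
      constructor <;> intro h1 <;> nlinarith
    rw [e1, e2, Complex.volume_real_sector_inner hu hR.le]
    · exact (Complex.volume_real_cap_inner_le hu (by positivity) (by linarith)).trans
        (cap_area_le_mul_arccos hR hR2 (by linarith) (by linarith))
    · have : 0 < ‖v‖ / 2 / R := by positivity
      linarith
    · rw [div_le_one hR]; linarith
  · have : {z : ℂ | ‖z‖ < R ∧ ‖v‖ ^ 2 ≤ 2 * inner ℝ v z} = ∅ := by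
      rw [eq_empty_iff_forall_notMem]
      rintro z ⟨h1, h2⟩
      have := real_inner_le_norm v z
      nlinarith
    rw [this, measureReal_empty]
    refine mul_nonneg ?_ measureReal_nonneg
    rw [sub_nonneg, div_le_one (by positivity)]
    have h32 : √3 < 1.7321 := (Real.sqrt_lt' (by norm_num)).2 (by norm_num)
    linarith [Real.pi_gt_d4]

/-! ### Disjointness of sectors. -/

/-- A common direction would give a point `x` within `1/√3` of each of `0`, `v`, `w`, which are more
than 1 apart. -/
theorem not_mem_two_sectors {E : Type*} [NormedAddCommGroup E] [InnerProductSpace ℝ E] {R : ℝ}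
    (hR2 : R ^ 2 = 1 / 3) {v w z : E} (hv : 1 < ‖v‖) (hw : 1 < ‖w‖)
    (hvw : 1 < ‖v - w‖) (hz : 0 < ‖z‖) (hzv : ‖z‖ * ‖v‖ ^ 2 ≤ 2 * R * inner ℝ v z)
    (hzw : ‖z‖ * ‖w‖ ^ 2 ≤ 2 * R * inner ℝ w z) : False := by
  have key : ∀ u : E, ‖z‖ * ‖u‖ ^ 2 ≤ 2 * R * inner ℝ u z →
      ‖u‖ ^ 2 ≤ 2 * inner ℝ u ((R / ‖z‖) • z) := fun u hu => by
    rw [real_inner_smul_right, ← mul_assoc, mul_div_assoc', div_mul_eq_mul_div, le_div_iff₀ hz]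
    linarith
  have hx : ‖(R / ‖z‖) • z‖ ^ 2 = 1 / 3 := by
    rw [norm_smul, mul_pow, Real.norm_eq_abs, sq_abs, div_pow, hR2]
    field_simp
  have h1 := key v hzv
  have h2 := key w hzw
  generalize (R / ‖z‖) • z = x at h1 h2 hx
  -- This is 9 times the squared distance from `x` to the centroid of `0`, `v`, `w`; the hypotheses
  -- bound it by `2 - ‖v‖² - ‖w‖² < 0`.
  have h3 : 0 ≤ ‖v + w - (3 : ℝ) • x‖ ^ 2 := sq_nonneg _
  rw [norm_sub_sq_real, norm_add_sq_real, inner_add_left, real_inner_smul_right,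
    real_inner_smul_right, norm_smul, mul_pow, hx] at h3
  have h4 := norm_sub_sq_real v w
  norm_num at h3
  nlinarith

/-- The direction of `z` is within `π/6` of `v`, while `v` is nearly orthogonal to `e` or points
away from it, so `z` cannot be close to `e`. Cauchy–Schwarz for the components orthogonal to `e`
gives `(√3/2 - δa)² ≤ 1 - a²`, which `hc` excludes. -/
theorem not_mem_sector_of_inner_le {E : Type*} [NormedAddCommGroup E] [InnerProductSpace ℝ E]
    {R δ c : ℝ} (hR : 0 < R) (hR2 : R ^ 2 = 1 / 3) (hδ0 : 0 ≤ δ) (hδ : δ ≤ 1 / 2) (hc0 : 0 ≤ c)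
    (hc : ∀ a, c ≤ a → 1 / 4 < (1 + δ ^ 2) * a ^ 2 - √3 * δ * a) {e v z : E} (he : ‖e‖ = 1)
    (hv : 1 < ‖v‖) (hve : inner ℝ v e ≤ δ) (hz : 0 < ‖z‖) (hze : c * ‖z‖ ≤ inner ℝ e z)
    (hzv : ‖z‖ * ‖v‖ ^ 2 ≤ 2 * R * inner ℝ v z) : False := by
  have h3 : √3 ^ 2 = 3 := Real.sq_sqrt (by norm_num)
  have h31 : 1.732 < √3 := Real.lt_sqrt_of_sq_lt (by norm_num)
  have hR3 : √3 * R = 1 := by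
    have : (√3 * R) ^ 2 = 1 ^ 2 := by rw [mul_pow, h3, hR2]; norm_num
    exact (pow_left_inj₀ (by positivity) zero_le_one two_ne_zero).1 this
  have hx : ‖‖z‖⁻¹ • z‖ = 1 := by
    rw [norm_smul, norm_inv, norm_norm, inv_mul_cancel₀ hz.ne']
  have h1 : c ≤ inner ℝ e (‖z‖⁻¹ • z) := by
    rw [real_inner_smul_right, inv_mul_eq_div, le_div_iff₀ hz]; exact hze
  have h2 : √3 * ‖v‖ ^ 2 ≤ 2 * inner ℝ v (‖z‖⁻¹ • z) := by
    rw [real_inner_smul_right, inv_mul_eq_div, mul_div_assoc', le_div_iff₀ hz]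
    calc √3 * ‖v‖ ^ 2 * ‖z‖ = √3 * (‖z‖ * ‖v‖ ^ 2) := by ring
      _ ≤ √3 * (2 * R * inner ℝ v z) := by gcongr
      _ = 2 * (√3 * R) * inner ℝ v z := by ring
      _ = 2 * inner ℝ v z := by rw [hR3, mul_one]
  generalize ‖z‖⁻¹ • z = x at hx h1 h2
  have ha1 : inner ℝ e x ≤ 1 := by simpa [he, hx] using real_inner_le_norm e x
  have hcs := real_inner_mul_inner_self_le (v - inner ℝ v e • e) (x - inner ℝ e x • e)
  have hee : inner ℝ e e = (1 : ℝ) := by rw [real_inner_self_eq_norm_sq, he, one_pow]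
  have hxx : inner ℝ x x = (1 : ℝ) := by rw [real_inner_self_eq_norm_sq, hx, one_pow]
  simp only [inner_sub_left, inner_sub_right, real_inner_smul_left, real_inner_smul_right, hee,
    hxx, real_inner_comm v e, real_inner_comm e x] at hcs
  rw [real_inner_self_eq_norm_sq] at hcs
  have hca := hc _ h1
  have hex0 := hc0.trans h1
  generalize inner ℝ e x = a at *
  generalize inner ℝ v x = P at *
  generalize inner ℝ v e = b at *
  generalize ‖v‖ = l at *
  have hl0 : 0 < l := by linarith
  have hb : a * b ≤ a * (δ * l) := mul_le_mul_of_nonneg_left (by nlinarith) hex0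
  have hk : 0 ≤ √3 / 2 - δ * a := by nlinarith
  have hP : (√3 / 2 - δ * a) * l ≤ P - a * b := by nlinarith [mul_pos hl0 (sub_pos.2 hv)]
  have hsq : ((√3 / 2 - δ * a) * l) ^ 2 ≤ (P - a * b) ^ 2 := pow_le_pow_left₀ (by positivity) hP 2
  have h5 : (P - a * b) ^ 2 ≤ (l ^ 2 - b ^ 2) * (1 - a ^ 2) := by linarith
  have h6 : (l ^ 2 - b ^ 2) * (1 - a ^ 2) ≤ l ^ 2 * (1 - a ^ 2) := by
    have ha2 : 0 ≤ 1 - a ^ 2 := by nlinarith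
    nlinarith [mul_nonneg (sq_nonneg b) ha2]
  have h7 : (√3 / 2 - δ * a) ^ 2 ≤ 1 - a ^ 2 := by
    have hl2 : 0 < l ^ 2 := by positivity
    refine le_of_mul_le_mul_left ?_ hl2
    linarith
  linarith

theorem Complex.measurableSet_sector (R : ℝ) (v : ℂ) (k l : ℝ) :
    MeasurableSet {z : ℂ | 0 < ‖z‖ ∧ ‖z‖ < R ∧ k * ‖z‖ ≤ l * inner ℝ v z} :=
  (measurableSet_lt measurable_const measurable_norm).inter
    ((measurableSet_lt measurable_norm measurable_const).inter
      (measurableSet_le (measurable_norm.const_mul k)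
        ((continuous_const.inner continuous_id).measurable.const_mul l)))

/-! ### The loss at the boundary of the large disk. -/

/-- The protruding part lies in a cap around the outward direction `e` of `p`. Neighbours stay in
the disk of radius `ρ`, so they have small or negative component along `e`, which leaves room for
the sector `T`. -/
theorem exists_boundary_sector {R ρ : ℝ} (hR : 0 < R) (hR2 : R ^ 2 = 1 / 3) (hρ : 1 ≤ ρ) {p : ℂ}
    (hp : ‖p‖ ≤ ρ) :
    ∃ T : Set ℂ, MeasurableSet T ∧ (∀ z ∈ T, 0 < ‖z‖ ∧ ‖z‖ < R) ∧
      volume.real {z : ℂ | ‖z‖ < R ∧ ρ + 1 / 2 < ‖p + z‖} ≤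
        (1 - 3 * √3 / (2 * Real.pi)) * volume.real T ∧
      ∀ v : ℂ, 1 < ‖v‖ → ‖p + v‖ ≤ ρ → ∀ z ∈ T, ¬ ‖z‖ * ‖v‖ ^ 2 ≤ 2 * R * inner ℝ v z := by
  have h3 : √3 ^ 2 = 3 := Real.sq_sqrt (by norm_num)
  have h31 : 1.732 < √3 := Real.lt_sqrt_of_sq_lt (by norm_num)
  have h32 : √3 < 1.7321 := (Real.sqrt_lt' (by norm_num)).2 (by norm_num)
  have hR1 : R < 0.5774 := lt_of_pow_lt_pow_left₀ 2 (by norm_num) (by rw [hR2]; norm_num)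
  have hR0 : 0.5773 < R := lt_of_pow_lt_pow_left₀ 2 hR.le (by rw [hR2]; norm_num)
  have hR3 : √3 * R = 1 := by
    have : (√3 * R) ^ 2 = 1 ^ 2 := by rw [mul_pow, h3, hR2]; norm_num
    exact (pow_left_inj₀ (by positivity) zero_le_one two_ne_zero).1 this
  have hfin : ∀ {t : ℝ} {e : ℂ}, volume {z : ℂ | ‖z‖ < R ∧ t ≤ inner ℝ e z} ≠ ∞ := fun {t e} =>
    ne_top_of_le_ne_top (b := volume (Metric.ball (0 : ℂ) R)) measure_ball_lt_top.ne
      (measure_mono fun z hz => by simpa using hz.1)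
  rcases le_or_gt ‖p‖ (ρ + 1 / 2 - R) with h | h
  · refine ⟨∅, MeasurableSet.empty, by simp, ?_, by simp⟩
    have : {z : ℂ | ‖z‖ < R ∧ ρ + 1 / 2 < ‖p + z‖} = ∅ := by
      rw [eq_empty_iff_forall_notMem]
      rintro z ⟨h1, h2⟩
      linarith [norm_add_le p z]
    rw [this, measureReal_empty, mul_zero]
  set s := ‖p‖ with hs
  have hs0 : 0 < s := by linarith
  obtain ⟨e, he, hpe⟩ : ∃ e : ℂ, ‖e‖ = 1 ∧ p = s • e := by
    refine ⟨s⁻¹ • p, ?_, ?_⟩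
    · rw [norm_smul, norm_inv, Real.norm_of_nonneg hs0.le, ← hs, inv_mul_cancel₀ hs0.ne']
    · rw [smul_smul, mul_inv_cancel₀ hs0.ne', one_smul]
  have hadd : ∀ z : ℂ, ‖p + z‖ ^ 2 = s ^ 2 + 2 * s * inner ℝ e z + ‖z‖ ^ 2 := fun z => by
    rw [norm_add_sq_real, ← hs]
    nth_rw 1 [hpe]
    rw [real_inner_smul_left]; ring
  have hve : ∀ v : ℂ, 1 < ‖v‖ → ‖p + v‖ ≤ ρ → inner ℝ v e ≤ ρ - s := fun v hv1 hv2 => by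
    have h1 := pow_le_pow_left₀ (norm_nonneg _) hv2 2
    rw [hadd, real_inner_comm] at h1
    have : 2 * s * inner ℝ v e ≤ 2 * s * (ρ - s) := by nlinarith
    exact le_of_mul_le_mul_left this (by positivity)
  have hcap : ∀ z : ℂ, ‖z‖ < R → ρ + 1 / 2 < ‖p + z‖ →
      (ρ + 1 / 2) ^ 2 - s ^ 2 - 1 / 3 < 2 * s * inner ℝ e z := fun z hz1 hz2 => by
    have h1 := pow_lt_pow_left₀ hz2 (by linarith) two_ne_zero
    have h2 := pow_lt_pow_left₀ hz1 (norm_nonneg _) two_ne_zero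
    rw [hadd] at h1
    linarith
  -- Above 0.03 the protruding part lies in the cap of a virtual neighbour at `p + e`, and `ρ - s <
  -- R - 1/2 < 0.08`. Below it the cap is larger, but neighbours are almost orthogonal to `e` or
  -- beyond, so a wider sector is free.
  rcases le_or_gt (ρ - s) 0.03 with hδ | hδ
  · refine ⟨{z : ℂ | 0 < ‖z‖ ∧ ‖z‖ < R ∧ 53 / 100 * ‖z‖ ≤ 1 * inner ℝ e z},
      Complex.measurableSet_sector R e _ _, fun z hz => ⟨hz.1, hz.2.1⟩, ?_, ?_⟩
    · simp only [one_mul]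
      rw [Complex.volume_real_sector_inner he hR.le (by norm_num) (by norm_num)]
      have hsub : {z : ℂ | ‖z‖ < R ∧ ρ + 1 / 2 < ‖p + z‖} ⊆
          {z : ℂ | ‖z‖ < R ∧ 11 / 24 ≤ inner ℝ e z} := by
        refine fun z hz => ⟨hz.1, ?_⟩
        have h1 := hcap z hz.1 hz.2
        -- The worst case is `s = ρ = 1`, where the bound of `hcap` is exactly `11/12`.
        have : 2 * s * (11 / 24) ≤ 2 * s * inner ℝ e z := by nlinarith
        exact le_of_mul_le_mul_left this (by positivity)
      exact (measureReal_mono hsub hfin).trans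
        ((Complex.volume_real_cap_inner_le he (t := 11 / 24) (by norm_num) (by linarith)).trans
          (cap_area_le_mul_arccos_of_wide hR hR2))
    · rintro v hv1 hv2 z ⟨hz1, hz2, hz3⟩ hz4
      rw [one_mul] at hz3
      refine not_mem_sector_of_inner_le hR hR2 (δ := 0.03) (by norm_num) (by norm_num)
        (c := 53 / 100) (by norm_num) (fun a ha => ?_) he hv1 ((hve v hv1 hv2).trans hδ) hz1 hz3 hz4
      nlinarith
  · refine ⟨{z : ℂ | 0 < ‖z‖ ∧ ‖z‖ < R ∧ ‖e‖ ^ 2 * ‖z‖ ≤ 2 * R * inner ℝ e z},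
      Complex.measurableSet_sector R e _ _, fun z hz => ⟨hz.1, hz.2.1⟩, ?_, ?_⟩
    · have hfin' : volume {z : ℂ | ‖z‖ < R ∧ ‖e‖ ^ 2 ≤ 2 * inner ℝ e z} ≠ ∞ :=
        ne_top_of_le_ne_top (b := volume (Metric.ball (0 : ℂ) R)) measure_ball_lt_top.ne
          (measure_mono fun z hz => by simpa using hz.1)
      have hmain := volume_real_cap_le_sector hR hR2 (v := e) he.ge
      simp only [mul_comm ‖_‖ (‖e‖ ^ 2)] at hmain
      have hsub : {z : ℂ | ‖z‖ < R ∧ ρ + 1 / 2 < ‖p + z‖} ⊆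
          {z : ℂ | ‖z‖ < R ∧ ‖e‖ ^ 2 ≤ 2 * inner ℝ e z} := by
        refine fun z hz => ⟨hz.1, ?_⟩
        have h1 := hcap z hz.1 hz.2
        rw [he]
        have : s * 1 ^ 2 ≤ s * (2 * inner ℝ e z) := by nlinarith
        exact le_of_mul_le_mul_left this hs0
      exact (measureReal_mono hsub hfin').trans hmain
    · rintro v hv1 hv2 z ⟨hz1, hz2, hz3⟩ hz4
      refine not_mem_sector_of_inner_le hR hR2 (δ := 0.08) (by norm_num) (by norm_num)
        (c := √3 / 2) (by positivity) (fun a ha => ?_) he hv1 ((hve v hv1 hv2).trans (by linarith))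
        hz1 ?_ hz4
      · nlinarith
      · rw [he, one_pow, one_mul] at hz3
        nlinarith

/-! ### Truncated Voronoi cells and the packing bound. -/

/-- The Voronoi cell of `p` with respect to `S`, translated by `-p` and truncated to the disk of
radius `R` around `p` and to the disk of radius `ρ` around the origin. -/
def truncatedCell (R ρ : ℝ) (S : Finset ℂ) (p : ℂ) : Set ℂ :=
  {z | ‖z‖ < R ∧ ‖p + z‖ ≤ ρ ∧ ∀ q ∈ S, q ≠ p → ‖z‖ < ‖z - (q - p)‖}

theorem measurableSet_truncatedCell (R ρ : ℝ) (S : Finset ℂ) (p : ℂ) :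
    MeasurableSet (truncatedCell R ρ S p) := by
  refine (measurableSet_lt measurable_norm measurable_const).inter
    ((measurableSet_le (by fun_prop : Measurable fun z : ℂ => ‖p + z‖) measurable_const).inter ?_)
  have : {z : ℂ | ∀ q ∈ S, q ≠ p → ‖z‖ < ‖z - (q - p)‖} =
      ⋂ q ∈ S, ⋂ _ : q ≠ p, {z : ℂ | ‖z‖ < ‖z - (q - p)‖} := by
    ext z; simp
  refine (congrArg MeasurableSet this).mpr ?_
  refine Finset.measurableSet_biInter S fun q _ => MeasurableSet.iInter fun _ => ?_
  exact measurableSet_lt measurable_norm (by fun_prop : Measurable fun z : ℂ => ‖z - (q - p)‖)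

theorem le_volume_real_truncatedCell {R ρ : ℝ} (hR : 0 < R) (hR2 : R ^ 2 = 1 / 3) (hρ : 1 ≤ ρ)
    {S : Finset ℂ} (hS : ∀ p ∈ S, ∀ q ∈ S, p ≠ q → 1 < ‖p - q‖) (hSρ : ∀ p ∈ S, ‖p‖ ≤ ρ)
    {p : ℂ} (hp : p ∈ S) :
    √3 / 2 ≤ volume.real (truncatedCell R (ρ + 1 / 2) S p) := by
  classical
  set κ := 1 - 3 * √3 / (2 * Real.pi) with hκ
  have hκ0 : 0 ≤ κ := by
    rw [hκ, sub_nonneg, div_le_one (by positivity)]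
    have h32 : √3 < 1.7321 := (Real.sqrt_lt' (by norm_num)).2 (by norm_num)
    linarith [Real.pi_gt_d4]
  obtain ⟨T, hTm, hTR, hTvol, hTdisj⟩ := exists_boundary_sector hR hR2 hρ (hSρ p hp)
  let cap : ℂ → Set ℂ := fun q => {z | ‖z‖ < R ∧ ‖q - p‖ ^ 2 ≤ 2 * inner ℝ (q - p) z}
  let sec : ℂ → Set ℂ := fun q =>
    {z | 0 < ‖z‖ ∧ ‖z‖ < R ∧ ‖z‖ * ‖q - p‖ ^ 2 ≤ 2 * R * inner ℝ (q - p) z}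
  have hsecm : ∀ q, MeasurableSet (sec q) := fun q => by
    have := Complex.measurableSet_sector R (q - p) (‖q - p‖ ^ 2) (2 * R)
    simpa only [mul_comm (‖q - p‖ ^ 2)] using this
  have hball : volume.real (Metric.ball (0 : ℂ) R) = Real.pi / 3 := by
    rw [measureReal_def, Complex.volume_ball, ENNReal.toReal_mul, ENNReal.toReal_pow,
      ENNReal.toReal_ofReal hR.le, hR2]
    simp; ring
  have hballfin : volume (Metric.ball (0 : ℂ) R) ≠ ∞ := measure_ball_lt_top.ne
  have hfin : ∀ s : Set ℂ, (∀ z ∈ s, ‖z‖ < R) → volume s ≠ ∞ := fun s hs =>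
    ne_top_of_le_ne_top hballfin (measure_mono fun z hz => by simpa using hs z hz)
  have hpos : ∀ q ∈ S.erase p, 1 < ‖q - p‖ := fun q hq =>
    hS q (Finset.mem_of_mem_erase hq) p hp (Finset.ne_of_mem_erase hq)
  have hcap : ∀ q ∈ S.erase p, volume.real (cap q) ≤ κ * volume.real (sec q) := fun q hq =>
    volume_real_cap_le_sector hR hR2 (hpos q hq).le
  have hsum : ∑ q ∈ S.erase p, volume.real (sec q) + volume.real T ≤ Real.pi / 3 := by
    rw [← hball, ← measureReal_biUnion_finset ?_ (fun q _ => hsecm q)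
      (fun q _ => hfin _ fun z hz => hz.2.1), ← measureReal_union ?_ hTm ?_ ?_]
    · refine measureReal_mono ?_ hballfin
      refine union_subset (iUnion₂_subset fun q _ z hz => ?_) fun z hz => ?_
      · simpa using hz.2.1
      · simpa using (hTR z hz).2
    · rw [Set.disjoint_left]
      intro z hz hzT
      obtain ⟨q, hq, hz1⟩ := mem_iUnion₂.1 hz
      refine hTdisj (q - p) (hpos q hq) ?_ z hzT hz1.2.2
      rw [add_sub_cancel]
      exact hSρ q (Finset.mem_of_mem_erase hq)
    · refine hfin _ fun z hz => ?_
      obtain ⟨q, hq, hz1⟩ := mem_iUnion₂.1 hz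
      exact hz1.2.1
    · exact hfin _ fun z hz => (hTR z hz).2
    · intro q hq q' hq' hne
      rw [Function.onFun, Set.disjoint_left]
      intro z hz hz'
      refine not_mem_two_sectors hR2 (hpos q hq) (hpos q' hq') ?_ hz.1 hz.2.2 hz'.2.2
      rw [sub_sub_sub_cancel_right]
      exact hS q (Finset.mem_of_mem_erase hq) q' (Finset.mem_of_mem_erase hq') hne
  have hcover : Metric.ball (0 : ℂ) R ⊆ truncatedCell R (ρ + 1 / 2) S p ∪
      ((⋃ q ∈ S.erase p, cap q) ∪ {z : ℂ | ‖z‖ < R ∧ ρ + 1 / 2 < ‖p + z‖}) := by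
    intro z hz
    have hzR : ‖z‖ < R := by simpa using hz
    by_contra hcon
    simp only [mem_union, not_or, mem_iUnion₂, not_exists] at hcon
    obtain ⟨h1, h2, h3⟩ := hcon
    refine h1 ⟨hzR, not_lt.1 fun h => h3 ⟨hzR, h⟩, fun q hq hqp => not_le.1 fun h => ?_⟩
    refine h2 q (Finset.mem_erase.2 ⟨hqp, hq⟩) ⟨hzR, ?_⟩
    have h4 := pow_le_pow_left₀ (norm_nonneg _) h 2
    rw [norm_sub_sq_real, real_inner_comm] at h4
    linarith
  have h1 : Real.pi / 3 ≤ volume.real (truncatedCell R (ρ + 1 / 2) S p) +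
      (∑ q ∈ S.erase p, volume.real (cap q) +
        volume.real {z : ℂ | ‖z‖ < R ∧ ρ + 1 / 2 < ‖p + z‖}) := by
    rw [← hball]
    refine (measureReal_mono hcover (hfin _ ?_)).trans ?_
    · rintro z (hz | hz | hz)
      · exact hz.1
      · obtain ⟨q, hq, hz1⟩ := mem_iUnion₂.1 hz
        exact hz1.1
      · exact hz.1
    · refine (measureReal_union_le _ _).trans ?_
      gcongr
      refine (measureReal_union_le _ _).trans ?_
      gcongr
      exact measureReal_biUnion_finset_le _ _
  have h2 : ∑ q ∈ S.erase p, volume.real (cap q) ≤ κ * ∑ q ∈ S.erase p, volume.real (sec q) := by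
    rw [Finset.mul_sum]
    exact Finset.sum_le_sum hcap
  have h3 := mul_le_mul_of_nonneg_left hsum hκ0
  have h4 : κ * (Real.pi / 3) = Real.pi / 3 - √3 / 2 := by
    rw [hκ]; field_simp
  rw [mul_add, h4] at h3
  linarith

/-- A set of points of a disk of radius `ρ ≥ 1` with mutual distances larger than `1` satisfies the
hexagonal packing density bound in the concentric disk of radius `ρ + 1 / 2`. -/
theorem card_mul_le_of_one_lt_dist {ρ : ℝ} (hρ : 1 ≤ ρ)
    {S : Finset ℂ} (hS : ∀ p ∈ S, ∀ q ∈ S, p ≠ q → 1 < ‖p - q‖) (hSρ : ∀ p ∈ S, ‖p‖ ≤ ρ) :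
    S.card * (√3 / 2) ≤ Real.pi * (ρ + 1 / 2) ^ 2 := by
  obtain ⟨R, hR, hR2⟩ : ∃ R : ℝ, 0 < R ∧ R ^ 2 = 1 / 3 :=
    ⟨√(1 / 3), by positivity, Real.sq_sqrt (by norm_num)⟩
  let cell : ℂ → Set ℂ := fun p => (fun y => y - p) ⁻¹' truncatedCell R (ρ + 1 / 2) S p
  have hvol : ∀ p, volume.real (cell p) = volume.real (truncatedCell R (ρ + 1 / 2) S p) :=
    fun p => by
      rw [measureReal_def, measureReal_def]
      simp only [cell, sub_eq_add_neg]
      rw [measure_preimage_add_right]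
  have hmeas : ∀ p, MeasurableSet (cell p) := fun p =>
    measurableSet_truncatedCell _ _ _ _ |>.preimage (by fun_prop)
  have hsub : ∀ p, cell p ⊆ Metric.closedBall 0 (ρ + 1 / 2) := fun p y hy => by
    have := hy.2.1
    simpa using this
  have hfin : volume (Metric.closedBall (0 : ℂ) (ρ + 1 / 2)) ≠ ∞ := measure_closedBall_lt_top.ne
  have hdisk : volume.real (Metric.closedBall (0 : ℂ) (ρ + 1 / 2)) = Real.pi * (ρ + 1 / 2) ^ 2 := by
    rw [measureReal_def, Complex.volume_closedBall, ENNReal.toReal_mul, ENNReal.toReal_pow,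
      ENNReal.toReal_ofReal (by linarith)]
    simp; ring
  calc S.card * (√3 / 2) = ∑ p ∈ S, √3 / 2 := by rw [Finset.sum_const, nsmul_eq_mul]
    _ ≤ ∑ p ∈ S, volume.real (cell p) := Finset.sum_le_sum fun p hp => by
        rw [hvol]; exact le_volume_real_truncatedCell hR hR2 hρ hS hSρ hp
    _ = volume.real (⋃ p ∈ S, cell p) := by
        rw [measureReal_biUnion_finset ?_ (fun p _ => hmeas p)
          (fun p _ => ne_top_of_le_ne_top hfin (measure_mono (hsub p)))]
        intro p hp q hq hne
        rw [Function.onFun, Set.disjoint_left]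
        intro y hy hy'
        have h1 := hy.2.2 q hq hne.symm
        have h2 := hy'.2.2 p hp hne
        simp only [sub_sub_sub_cancel_right] at h1 h2
        linarith
    _ ≤ volume.real (Metric.closedBall (0 : ℂ) (ρ + 1 / 2)) :=
        measureReal_mono (iUnion₂_subset fun p _ => hsub p) hfin
    _ = Real.pi * (ρ + 1 / 2) ^ 2 := hdisk

/-! ### Application to unit disk graphs. -/

theorem dist_le_of_mem_closedNeighborhood {V X : Type*} [PseudoMetricSpace X]
    {G : SimpleGraph V} {f : V → X} (hf : ∀ u v, G.Adj u v → dist (f u) (f v) ≤ 1) {r : ℕ} {v w : V}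
    (hw : w ∈ G.closedNeighborhood r v) : dist (f v) (f w) ≤ r := by
  have hwalk : ∀ {a b : V} (p : G.Walk a b), dist (f a) (f b) ≤ p.length := by
    intro a b p
    induction p with
    | nil => simp
    | cons h p ih =>
      rw [SimpleGraph.Walk.length_cons, Nat.cast_add, Nat.cast_one]
      linarith [(dist_triangle _ _ _).trans (add_le_add (hf _ _ h) ih)]
  have hw' : G.edist v w ≤ r := hw
  have hreach : G.Reachable v w := by
    rw [← SimpleGraph.edist_ne_top_iff_reachable]
    exact ne_top_of_le_ne_top (ENat.natCast_ne_top r) hw'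
  obtain ⟨p, hp⟩ := hreach.exists_walk_length_eq_edist
  rw [← hp, Nat.cast_le] at hw'
  exact (hwalk p).trans (by exact_mod_cast hw')

theorem mainTheorem7 {V : Type*} [Finite V] (G : SimpleGraph V) (hG : G.IsUnitDiskGraph)
    (r : ℕ) (hr : 1 ≤ r) (v : V) (S : Set V) (hS : G.IsIndepSet S)
    (hSv : S ⊆ G.closedNeighborhood r v) :
    S.ncard ≤ ⌊Real.pi * (2 * (r : ℝ) + 1) ^ 2 / Real.sqrt 12⌋₊ := by
  classical
  obtain ⟨p, hp⟩ := hG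
  let ι : ℂ ≃ₗᵢ[ℝ] EuclideanSpace ℝ (Fin 2) := Complex.orthonormalBasisOneI.repr
  let f : V → ℂ := fun w => ι.symm (p w) - ι.symm (p v)
  have hf : ∀ a b, ‖f a - f b‖ = dist (p a) (p b) := fun a b => by
    rw [sub_sub_sub_cancel_right, ← dist_eq_norm, ι.symm.dist_map]
  have hsep : ∀ a ∈ S, ∀ b ∈ S, a ≠ b → 1 < ‖f a - f b‖ := fun a ha b hb hab => by
    rw [hf]
    by_contra! h
    exact hS ha hb hab ((hp a b).2 ⟨hab, h⟩)
  have hinj : Set.InjOn f S := fun a ha b hb hab => by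
    by_contra hne
    have := hsep a ha b hb hne
    rw [hab, sub_self, norm_zero] at this
    linarith
  have hfinS : S.Finite := S.toFinite
  have hcard : (hfinS.toFinset.image f).card = S.ncard := by
    rw [Finset.card_image_of_injOn (by simpa using hinj), Set.ncard_eq_toFinset_card S hfinS]
  have hmain := card_mul_le_of_one_lt_dist (ρ := r) (by exact_mod_cast hr)
    (S := hfinS.toFinset.image f) ?_ ?_
  · refine Nat.le_floor ?_
    have h12 : Real.sqrt 12 = 2 * √3 := by
      rw [show (12 : ℝ) = 2 ^ 2 * 3 by norm_num, Real.sqrt_mul (by norm_num),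
        Real.sqrt_sq (by norm_num)]
    rw [hcard] at hmain
    rw [h12, le_div_iff₀ (by positivity)]
    linarith
  · simp only [Finset.mem_image, Set.Finite.mem_toFinset]
    rintro _ ⟨a, ha, rfl⟩ _ ⟨b, hb, rfl⟩ hab
    exact hsep a ha b hb fun h => hab (h ▸ rfl)
  · simp only [Finset.mem_image, Set.Finite.mem_toFinset]
    rintro _ ⟨a, ha, rfl⟩
    have h1 := dist_le_of_mem_closedNeighborhood
      (fun a b hab => ((hp a b).1 hab).2) (hSv ha)
    rwa [dist_comm, ← ι.symm.dist_map, dist_eq_norm] at h1
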